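/- For a positive integer $N$, an integer $h$ and $\epsilon\in\{0,1\}$, let $$\theta_{N,h}^{(\epsilon)}(\tau)=\sum_{\substack{n\in\mathbb{Z}\\ n\equiv h\,(\mathrm{mod}\,N)}} n^{\epsilon}\,q^{n^2/2N},\qquad \eta(\tau)=q^{1/24}\prod_{n=1}^{\infty}(1-q^n)\qquad (\tau\in\mathcal{H}),$$ where $q^x=e^{2\pi i x\tau}$ and $0^0=1$, and $\mathcal{H}$ is the complex upper half-plane. For $M\ge 1$ let $\Gamma(M)$ be the principal congruence subgroup of level $M$ of $\mathrm{SL}_2(\mathbb{Z})$, acting on $\mathcal{H}$ by $\gamma(\tau)=\frac{a\tau+b}{c\tau+d}$ for $\gamma=\begin{pmatrix}a&b\\c&d\end{pmatrix}$. Put $w=\dfrac{24N}{(12,N)}$, where $(12,N)$ is the greatest common divisor. Then the function $$\tau\mapsto\frac{\theta_{N,h}^{(\epsilon)}(\tau)}{\eta(\tau)^{1+2\epsilon}}$$ on $\mathcal{H}$ is invariant under $\Gamma(w)$, that is, it takes the same value at $\gamma(\tau)$ and at $\tau$ for all $\gamma\in\Gamma(w)$ and $\tau\in\mathcal{H}$.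 Likewise the function $$\tau\mapsto\frac{\theta_{N,h}^{(\epsilon)}(\tau/N)}{\eta(\tau/N)^{1+2\epsilon}}$$ on $\mathcal{H}$ is invariant under $\Gamma(wN)$. -/

import Mathlib

open scoped UpperHalfPlane MatrixGroups

/-- The partial theta series `θ_{N,h}^{(ε)}(τ) = ∑_{n ∈ ℤ, n ≡ h mod N} n^ε q^{n²/(2N)}`, with
`q^x = exp(2πixτ)`; the convention `0^0 = 1` is in force. -/
noncomputable def partialTheta (ε N : ℕ) (h : ℤ) (τ : ℂ) : ℂ :=
  ∑' n : {n : ℤ // n ≡ h [ZMOD (N : ℤ)]},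
    ((n : ℤ) : ℂ) ^ ε *
      Complex.exp (2 * Real.pi * Complex.I * τ * (((n : ℤ) : ℂ) ^ 2 / (2 * (N : ℂ))))

/-- The level `w = 24N/(12,N)`; the division is exact because `(12,N)` divides `24`. -/
def thetaLevel (N : ℕ) : ℕ := 24 * N / Nat.gcd 12 N

/-!
The quotient is invariant because theta series of every level `N` share one automorphy factor.

Let `Θ_{N,h}(z, τ) = ∑_{n ≡ h mod N} exp (2πi n z) q^{n²/(2N)}` and let `(a b; c p)` be an integral
matrix of determinant one with `p` prime, `2N ∣ b, c` and `p ≡ 1 mod N`. Since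
`(aτ + b)/(cτ + p) = b/p + (τ/(cτ + p))/p`, the series at the transformed point can be split
according to residues modulo `p`. The functional equation of the Jacobi theta function turns the
residue class into a translation of `z`. As `-(cτ + p)/τ = -c - p/τ`, recombining the pieces only
requires completing a square modulo `p` (`sum_stdAddChar_quadratic`), and it gives back
`Θ_{N,h}(z, τ)` times an explicit factor (`charTheta_mobius`). Apart from the square roots, this
factor contains the quadratic Gauss sum of `b N / 2` modulo `p`. If `2N` is a square modulo `p`,
which quadratic reciprocity provides for `p ≡ 1` modulo `24` and `2N`, it equals the Gauss sum of
`b`. The factor `J` (`thetaFactor`) is then independent of `N` and `h`, and `J² = cτ + p` because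
the Gauss sum has square `p`. The value and the `z`-derivative at `z = 0` give the transformation
law of `θ_{N,h}^{(ε)}`, with factor `J (cτ + p)^ε = J^{1+2ε}` (`partialTheta_mobius`).

By the pentagonal number theorem `η = θ_{12,1} - θ_{12,7}` (`eta_eq_partialTheta_sub`), so `η` has
the automorphy factor `J` too, and the factors cancel in the quotient. For a matrix with arbitrary
lower right entry `d` and `c ≠ 0`, a translation of `τ` by a multiple of the level `w` replaces `d`
by a prime, by Dirichlet's theorem; the quotient is invariant under such translations because `w`
is divisible by `24` and `2N` (`partialTheta_div_eta_mobius`). Conjugation by `diag(N, 1)` reduces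
the second claim to the first.
-/

/-! ### Quadratic Gauss sums -/

/-- The quadratic Gauss sum `∑ x mod p, exp (2πi b x² / p)`. -/
noncomputable def quadGaussSum (p : ℕ) [NeZero p] (b : ZMod p) : ℂ :=
  ∑ x : ZMod p, ZMod.stdAddChar (b * x ^ 2)

lemma quadGaussSum_mul_sq {p : ℕ} [Fact p.Prime] (b : ZMod p) {r : ZMod p} (hr : r ≠ 0) :
    quadGaussSum p (b * r ^ 2) = quadGaussSum p b := by
  unfold quadGaussSum
  rw [← Equiv.sum_comp (Equiv.mulLeft₀ r hr) fun x ↦ ZMod.stdAddChar (b * x ^ 2)]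
  refine Finset.sum_congr rfl fun x _ ↦ ?_
  rw [Equiv.mulLeft₀_apply, mul_pow, mul_assoc]

/-- As `-1` is a square modulo `p`, the square of the Gauss sum is the character sum of the
hyperbolic form `x² - y²`. -/
lemma quadGaussSum_sq {p : ℕ} [Fact p.Prime] (hp : p % 4 = 1) {b : ZMod p} (hb : b ≠ 0) :
    quadGaussSum p b ^ 2 = p := by
  have h2 : (2 : ZMod p) ≠ 0 := by
    intro h
    have h' : ((2 : ℕ) : ZMod p) = 0 := by exact_mod_cast h
    rw [ZMod.natCast_eq_zero_iff] at h'
    have := (Nat.prime_dvd_prime_iff_eq (Fact.out : p.Prime) Nat.prime_two).1 h'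
    omega
  obtain ⟨i, hi⟩ := ZMod.exists_sq_eq_neg_one_iff.2 (show p % 4 ≠ 3 by omega)
  have hi0 : i ≠ 0 := by
    rintro rfl
    simp at hi
  have hneg : quadGaussSum p b = ∑ y : ZMod p, ZMod.stdAddChar (-b * y ^ 2) := by
    rw [← quadGaussSum_mul_sq b hi0, quadGaussSum, pow_two, ← hi, mul_neg_one]
  calc quadGaussSum p b ^ 2
      = (∑ y : ZMod p, ZMod.stdAddChar (-b * y ^ 2)) *
          ∑ x : ZMod p, ZMod.stdAddChar (b * x ^ 2) := by rw [pow_two, ← hneg, quadGaussSum]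
    _ = ∑ y : ZMod p, ∑ u : ZMod p,
          (ZMod.stdAddChar (b * u ^ 2) * ZMod.stdAddChar (y * (2 * b * u)) : ℂ) := by
        rw [Finset.sum_mul]
        refine Finset.sum_congr rfl fun y _ ↦ ?_
        rw [Finset.mul_sum, ← Equiv.sum_comp (Equiv.addLeft y)]
        refine Finset.sum_congr rfl fun u _ ↦ ?_
        rw [← AddChar.map_add_eq_mul, ← AddChar.map_add_eq_mul, Equiv.coe_addLeft]
        congr 1
        ring
    _ = ∑ u : ZMod p, ZMod.stdAddChar (b * u ^ 2) * (if u = 0 then (p : ℂ) else 0) := by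
        rw [Finset.sum_comm]
        refine Finset.sum_congr rfl fun u _ ↦ ?_
        rw [← Finset.mul_sum, AddChar.sum_mulShift _ (ZMod.isPrimitive_stdAddChar p)]
        simp [hb, h2]
    _ = p := by simp

/-- Quadratic reciprocity for the odd part of `n`, and the supplementary law for the prime `2`. -/
lemma isSquare_natCast_zmod {p n : ℕ} [Fact p.Prime] (hn : n ≠ 0) (h8 : p % 8 = 1)
    (hpn : p ≡ 1 [MOD n]) : IsSquare (n : ZMod p) := by
  obtain ⟨e, m, hm, rfl⟩ := Nat.exists_eq_two_pow_mul_odd hn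
  have hpm : p ≡ 1 [MOD m] := hpn.of_mul_left _
  have h2 : IsSquare (2 : ZMod p) :=
    (ZMod.exists_sq_eq_two_iff (by rintro rfl; omega)).2 (Or.inl h8)
  have h : IsSquare ((m : ℤ) : ZMod p) := by
    refine ZMod.isSquare_of_jacobiSym_eq_one ?_
    rw [jacobiSym.quadratic_reciprocity_one_mod_four' hm (by omega),
      jacobiSym.mod_left' (a₂ := 1) (by exact_mod_cast hpm), jacobiSym.one_left]
  push_cast at h ⊢
  exact (h2.pow e).mul h

/-! ### The eta function as a theta series -/

lemma norm_prod_one_sub_pow_le {q : ℂ} (hq : ‖q‖ < 1) (k n : ℕ) :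
    ‖∏ i ∈ Finset.range n, (1 - q ^ (k + i + 1))‖ ≤ Real.exp (1 - ‖q‖)⁻¹ := by
  have h0 := norm_nonneg q
  calc ‖∏ i ∈ Finset.range n, (1 - q ^ (k + i + 1))‖
      ≤ ∏ i ∈ Finset.range n, Real.exp (‖q‖ ^ i) := by
        rw [norm_prod]
        refine Finset.prod_le_prod (fun _ _ ↦ norm_nonneg _) fun i _ ↦ ?_
        refine (norm_sub_le _ _).trans ?_
        rw [norm_one, norm_pow, add_comm]
        refine le_trans ?_ (Real.add_one_le_exp _)
        gcongr ?_ + 1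
        exact pow_le_pow_of_le_one h0 hq.le (by omega)
    _ ≤ Real.exp (1 - ‖q‖)⁻¹ := by
        rw [← Real.exp_sum, Real.exp_le_exp, ← tsum_geometric_of_lt_one h0 hq]
        exact (summable_geometric_of_lt_one h0 hq).sum_le_tsum _ fun _ _ ↦ by positivity

/-- **Pentagonal number theorem** in the open unit disc. -/
lemma tprod_one_sub_pow_eq_tsum {q : ℂ} (hq : ‖q‖ < 1) :
    ∏' n : ℕ, (1 - q ^ (n + 1)) =
      ∑' k : ℕ, (-1) ^ k * (q ^ pentagonal (-k) - q ^ pentagonal (k + 1)) := by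
  have h0 := norm_nonneg q
  set C := Real.exp (1 - ‖q‖)⁻¹
  have hle (k n : ℕ) : ‖q ^ ((k + 1) * n) * ∏ i ∈ Finset.range (n + 1), (1 - q ^ (k + i + 1))‖ ≤
      ‖q‖ ^ n * C := by
    rw [norm_mul, norm_pow]
    refine mul_le_mul (pow_le_pow_of_le_one h0 hq.le ?_) (norm_prod_one_sub_pow_le hq _ _)
      (norm_nonneg _) (by positivity)
    nlinarith
  have hC : Summable fun n ↦ ‖q‖ ^ n * C := (summable_geometric_of_lt_one h0 hq).mul_right C
  have hpent (k : ℕ) : k ≤ pentagonal (-k) ∧ k ≤ pentagonal (k + 1) := by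
    have h1 := two_mul_natCast_pentagonal_neg k
    have h2 := two_mul_natCast_pentagonal (k + 1)
    constructor <;> zify <;> nlinarith
  refine Pentagonal.tprod_one_sub_pow (tendsto_pow_atTop_nhds_zero_of_norm_lt_one hq)
    (fun k ↦ hC.of_norm_bounded (hle k)) (fun k ↦ ?_) ?_ ?_
  · have := multipliable_one_add_of_summable (f := fun n ↦ -q ^ (n + k + 1)) (by
      simpa [add_assoc] using
        (summable_nat_add_iff (k + 1)).mpr (summable_geometric_of_lt_one h0 hq))
    simpa [sub_eq_add_neg] using this
  · refine ((summable_geometric_of_lt_one h0 hq).mul_left 2).of_norm_bounded fun k ↦ ?_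
    rw [norm_mul, norm_pow, norm_neg, norm_one, one_pow, one_mul, two_mul]
    refine (norm_sub_le _ _).trans ?_
    rw [norm_pow, norm_pow]
    exact add_le_add (pow_le_pow_of_le_one h0 hq.le (hpent k).1)
      (pow_le_pow_of_le_one h0 hq.le (hpent k).2)
  · refine squeeze_zero_norm (a := fun k ↦ ‖q‖ ^ k * ∑' n, ‖q‖ ^ n * C) (fun k ↦ ?_) ?_
    · rw [norm_mul, norm_mul, norm_pow, norm_neg, norm_one, one_pow, one_mul, norm_pow]
      refine mul_le_mul (pow_le_pow_of_le_one h0 hq.le ?_)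
        (tsum_of_norm_bounded hC.hasSum (hle k)) (norm_nonneg _) (by positivity)
      rw [Nat.le_div_iff_mul_le two_pos]
      nlinarith
    · simpa using (tendsto_pow_atTop_nhds_zero_of_lt_one h0 hq).mul_const (∑' n, ‖q‖ ^ n * C)

/-! ### The inversion formula for theta series with a characteristic -/

/-- The two-variable theta series `∑ exp (2πi n z) q^{n²/(2N)}` over the integers `n = h + N m`. -/
noncomputable def charTheta (N : ℕ) (h : ℤ) (z τ : ℂ) : ℂ :=
  ∑' m : ℤ, Complex.exp (2 * Real.pi * Complex.I * (h + N * m) * z +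
    Real.pi * Complex.I * (h + N * m) ^ 2 / N * τ)

lemma charTheta_term_eq {N : ℕ} (hN : 0 < N) (h m : ℤ) (z τ : ℂ) :
    Complex.exp (2 * Real.pi * Complex.I * (h + N * m) * z +
      Real.pi * Complex.I * (h + N * m) ^ 2 / N * τ) =
    Complex.exp (2 * Real.pi * Complex.I * h * z + Real.pi * Complex.I * h ^ 2 / N * τ) *
      jacobiTheta₂_term m (N * z + h * τ) (N * τ) := by
  have hN' : (N : ℂ) ≠ 0 := by exact_mod_cast hN.ne'
  rw [jacobiTheta₂_term, ← Complex.exp_add]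
  congr 1
  field_simp
  ring

lemma im_natCast_mul_pos {N : ℕ} (hN : 0 < N) {τ : ℂ} (hτ : 0 < τ.im) :
    0 < ((N : ℂ) * τ).im := by
  rw [← Complex.ofReal_natCast, Complex.im_ofReal_mul]
  positivity

lemma summable_charTheta {N : ℕ} (hN : 0 < N) (h : ℤ) (z : ℂ) {τ : ℂ} (hτ : 0 < τ.im) :
    Summable fun m : ℤ ↦ Complex.exp (2 * Real.pi * Complex.I * (h + N * m) * z +
      Real.pi * Complex.I * (h + N * m) ^ 2 / N * τ) := by
  simp_rw [charTheta_term_eq hN]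
  exact (hasSum_jacobiTheta₂_term _ (im_natCast_mul_pos hN hτ)).summable.mul_left _

lemma charTheta_eq_jacobiTheta₂ {N : ℕ} (hN : 0 < N) (h : ℤ) (z τ : ℂ) :
    charTheta N h z τ =
    Complex.exp (2 * Real.pi * Complex.I * h * z + Real.pi * Complex.I * h ^ 2 / N * τ) *
      jacobiTheta₂ (N * z + h * τ) (N * τ) := by
  simp_rw [charTheta, charTheta_term_eq hN, tsum_mul_left, jacobiTheta₂]

lemma charTheta_add_mul (N : ℕ) (h k : ℤ) (z τ : ℂ) :
    charTheta N (h + N * k) z τ = charTheta N h z τ := by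
  rw [charTheta, charTheta]
  conv_rhs => rw [← (Equiv.addLeft k).tsum_eq]
  refine tsum_congr fun m ↦ ?_
  simp only [Equiv.coe_addLeft]
  push_cast
  congr 1
  ring

/-- Poisson summation: inversion turns the characteristic `h` into a translation of `z`. -/
lemma charTheta_inversion {N : ℕ} (hN : 0 < N) (h : ℤ) (z : ℂ) {τ : ℂ} (hτ : τ ≠ 0) :
    charTheta N h z τ = 1 / (-Complex.I * (N * τ)) ^ (1 / 2 : ℂ) *
      Complex.exp (-Real.pi * Complex.I * N * z ^ 2 / τ) *
        jacobiTheta₂ (z / τ + h / N) (-1 / (N * τ)) := by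
  have hN' : (N : ℂ) ≠ 0 := by exact_mod_cast hN.ne'
  rw [charTheta_eq_jacobiTheta₂ hN, jacobiTheta₂_functional_equation, ← mul_assoc, ← mul_assoc,
    mul_comm (Complex.exp _) (1 / _), mul_assoc (1 / _), ← Complex.exp_add]
  congr 3
  · field_simp
    ring
  · field_simp

/-! ### The action of matrices with prime lower right entry -/

lemma tsum_int_eq_sum_zmod {d : ℕ} [NeZero d] {f : ℤ → ℂ} (hf : Summable f) :
    ∑' m, f m = ∑ x : ZMod d, ∑' l : ℤ, f (x.val + d * l) := by
  obtain ⟨k, rfl⟩ := Nat.exists_eq_succ_of_ne_zero (NeZero.ne d)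
  rw [← (Int.divModEquiv (k + 1)).symm.tsum_eq, ← (Equiv.prodComm _ _).tsum_eq,
    Summable.tsum_prod, tsum_fintype]
  · refine Finset.sum_congr rfl fun x _ ↦ tsum_congr fun l ↦ ?_
    congr 1
    simp [Int.divModEquiv, ZMod.val]
    ring
  · exact ((Equiv.prodComm _ _).trans (Int.divModEquiv (k + 1)).symm).summable_iff.2 hf

/-- Splitting a theta series according to residues modulo `d`, where `d ≡ 1 mod N`; the
representatives `h d + N x` of the classes modulo `N d` are chosen so that `h` disappears
modulo `d`. -/
lemma charTheta_eq_sum {N d : ℕ} [NeZero d] (hN : 0 < N) (hd : d ≡ 1 [MOD N]) (h : ℤ) (z : ℂ)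
    {τ : ℂ} (hτ : 0 < τ.im) :
    charTheta N h z τ = ∑ x : ZMod d, ∑' l : ℤ,
      Complex.exp (2 * Real.pi * Complex.I * (((h * d + N * x.val : ℤ) : ℂ) + (N * d : ℕ) * l) * z +
      Real.pi * Complex.I * (((h * d + N * x.val : ℤ) : ℂ) + (N * d : ℕ) * l) ^ 2 / N * τ) := by
  obtain ⟨e, he⟩ := ((Nat.modEq_iff_dvd.1 hd.symm) : (N : ℤ) ∣ (d : ℤ) - (1 : ℕ))
  have hh : h * d = h + N * (h * e) := by
    rw [mul_left_comm, ← he]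
    push_cast
    ring
  rw [← charTheta_add_mul N h (h * e), ← hh, charTheta,
    tsum_int_eq_sum_zmod (d := d) (summable_charTheta hN _ z hτ)]
  refine Finset.sum_congr rfl fun x _ ↦ tsum_congr fun l ↦ ?_
  congr 1
  push_cast
  ring

/-- Completing the square. -/
lemma sum_stdAddChar_quadratic {p : ℕ} [Fact p.Prime] {α β : ZMod p} (h : 4 * α * β = -1)
    (n : ZMod p) :
    ∑ x : ZMod p, (ZMod.stdAddChar (α * x ^ 2 + x * n - β * n ^ 2) : ℂ) = quadGaussSum p α := by
  rw [quadGaussSum]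
  conv_rhs => rw [← Equiv.sum_comp (Equiv.subRight (2 * β * n))]
  refine Finset.sum_congr rfl fun x _ ↦ ?_
  congr 1
  rw [Equiv.subRight_apply]
  linear_combination (x * n - β * n ^ 2) * h

/-- The automorphy factor of weight `1/2` of a matrix `(a b; c p)` with `p` prime; the square roots
are principal branches, taken at points of the right half-plane. -/
noncomputable def thetaFactor (p : ℕ) [NeZero p] (b c : ℤ) (τ : ℂ) : ℂ :=
  1 / (-Complex.I * (p * (τ / (c * τ + p)))) ^ (1 / 2 : ℂ) * (-Complex.I * τ) ^ (1 / 2 : ℂ) *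
    quadGaussSum p b

lemma thetaFactor_sq {p : ℕ} [Fact p.Prime] (hp : p % 4 = 1) {b c : ℤ} (hb : (b : ZMod p) ≠ 0)
    {τ : ℂ} (hτ : τ ≠ 0) : thetaFactor p b c τ ^ 2 = c * τ + p := by
  have hp0 : (p : ℂ) ≠ 0 := by exact_mod_cast (Fact.out : p.Prime).ne_zero
  have hsq (w : ℂ) : (w ^ (1 / 2 : ℂ)) ^ 2 = w := by
    rw [one_div]
    exact_mod_cast Complex.cpow_nat_inv_pow w two_ne_zero
  rw [thetaFactor, mul_pow, mul_pow, div_pow, hsq, hsq, quadGaussSum_sq hp hb]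
  field_simp [Complex.I_ne_zero]

/-- The square root in the inversion formula at level `N p`, relative to the one at level `N`. -/
lemma one_div_cpow_natCast_mul {N : ℕ} (hN : 0 < N) {w : ℂ} (hw : w ≠ 0) :
    1 / (-Complex.I * (N * w)) ^ (1 / 2 : ℂ) =
      1 / (N : ℂ) ^ (1 / 2 : ℂ) * (1 / (-Complex.I * w) ^ (1 / 2 : ℂ)) := by
  have hw' : -Complex.I * w ≠ 0 := mul_ne_zero (neg_ne_zero.2 Complex.I_ne_zero) hw
  have hN' : (N : ℂ) ≠ 0 := by exact_mod_cast hN.ne'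
  have hlog : Complex.log (N * (-Complex.I * w)) =
      Complex.log N + Complex.log (-Complex.I * w) := by
    simpa using Complex.log_ofReal_mul (r := N) (by exact_mod_cast hN) hw'
  rw [one_div_mul_one_div, mul_left_comm, Complex.cpow_def_of_ne_zero (mul_ne_zero hN' hw'), hlog,
    add_mul, Complex.exp_add, ← Complex.cpow_def_of_ne_zero hN',
    ← Complex.cpow_def_of_ne_zero hw']

lemma mobius_eq {p : ℕ} (hp : p ≠ 0) {a b c : ℤ} (hdet : a * p - b * c = 1) {τ : ℂ}
    (hD : (c : ℂ) * τ + p ≠ 0) :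
    (a * τ + b) / (c * τ + p) = b / p + τ / (c * τ + p) / p := by
  have hp' : (p : ℂ) ≠ 0 := by exact_mod_cast hp
  have hdet' : (a : ℂ) * p - b * c = 1 := by exact_mod_cast hdet
  rw [← add_div, div_eq_div_iff hD hp']
  linear_combination τ * hdet' - div_mul_cancel₀ τ hD

lemma im_div_pos {p : ℕ} (hp : 0 < p) (c : ℤ) {τ : ℂ} (hτ : 0 < τ.im) :
    0 < (τ / (c * τ + p)).im := by
  have hD : 0 < Complex.normSq (c * τ + p) := by
    rw [Complex.normSq_pos]
    intro h
    have him := congrArg Complex.im h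
    have hre := congrArg Complex.re h
    simp at him hre
    rcases him with rfl | him
    · simp at hre
      omega
    · exact hτ.ne' him
  have : (τ / (c * τ + p)).im = p * τ.im / Complex.normSq (c * τ + p) := by
    rw [Complex.div_im]
    simp
    ring
  rw [this]
  positivity

/-- After splitting modulo `p`, the translation part `b / p` of the matrix contributes a
character value depending only on the residue class. -/
lemma charTheta_mobius_eq_sum {N p : ℕ} [Fact p.Prime] (hN : 0 < N) (hpN : p ≡ 1 [MOD N])
    {a b c : ℤ} (hdet : a * p - 2 * N * b * c = 1) (h : ℤ) (z : ℂ) {τ : ℂ} (hτ : 0 < τ.im) :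
    charTheta N h z ((a * τ + (2 * N * b : ℤ)) / (c * τ + p)) =
      ∑ x : ZMod p, ZMod.stdAddChar (b * N ^ 2 * x ^ 2 : ZMod p) *
        charTheta (N * p) (h * p + N * x.val) z (τ / (c * τ + p)) := by
  have hp : p ≠ 0 := (Fact.out : p.Prime).ne_zero
  have hp' : (p : ℂ) ≠ 0 := by exact_mod_cast hp
  have hN' : (N : ℂ) ≠ 0 := by exact_mod_cast hN.ne'
  have hσ := im_div_pos (Nat.pos_of_ne_zero hp) c hτ
  have hD : (c : ℂ) * τ + p ≠ 0 := by
    intro h0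
    rw [h0, div_zero] at hσ
    exact hσ.ne rfl
  rw [mobius_eq hp (by linear_combination hdet) hD]
  set σ := τ / (c * τ + p)
  have him : 0 < (((2 * N * b : ℤ) : ℂ) / p + σ / p).im := by
    rw [← Complex.ofReal_natCast p, ← Complex.ofReal_intCast, ← Complex.ofReal_div,
      Complex.add_im, Complex.ofReal_im, Complex.div_ofReal_im, zero_add]
    positivity
  rw [charTheta_eq_sum hN hpN h z him]
  refine Finset.sum_congr rfl fun x _ ↦ ?_
  rw [charTheta, ← tsum_mul_left]
  refine tsum_congr fun l ↦ ?_
  have hx : (b * N ^ 2 * x ^ 2 : ZMod p) =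
      ((b * ((h * p + N * x.val) + (N * p : ℕ) * l) ^ 2 : ℤ) : ZMod p) := by
    push_cast
    rw [ZMod.natCast_zmod_val, CharP.cast_eq_zero (ZMod p) p]
    ring
  rw [hx, ZMod.stdAddChar_coe, ← Complex.exp_add]
  congr 1
  push_cast
  field_simp
  ring

/-- A translation of `z` by `x / p` and of `τ` by a multiple of `2 / p` multiplies the terms of the
Jacobi theta series by values of the standard character modulo `p`. -/
lemma jacobiTheta₂_term_translate {p : ℕ} [NeZero p] (x : ZMod p) (c n : ℤ) (z τ : ℂ) :
    jacobiTheta₂_term n (z + x.val / p) (-(2 * c / p) + τ) =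
      ZMod.stdAddChar (x * n - c * n ^ 2 : ZMod p) * jacobiTheta₂_term n z τ := by
  have hx : (x * n - c * n ^ 2 : ZMod p) = ((x.val * n - c * n ^ 2 : ℤ) : ZMod p) := by
    push_cast
    rw [ZMod.natCast_zmod_val]
  have hp' : (p : ℂ) ≠ 0 := by exact_mod_cast NeZero.ne p
  rw [hx, ZMod.stdAddChar_coe, jacobiTheta₂_term, jacobiTheta₂_term, ← Complex.exp_add]
  congr 1
  push_cast
  field_simp
  ring

lemma sum_stdAddChar_mul_jacobiTheta₂ {p : ℕ} [Fact p.Prime] {α : ZMod p} {c : ℤ}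
    (h : 4 * α * c = -1) (z : ℂ) {τ : ℂ} (hτ : 0 < τ.im) :
    ∑ x : ZMod p, ZMod.stdAddChar (α * x ^ 2) *
      jacobiTheta₂ (z + x.val / p) (-(2 * c / p) + τ) =
    quadGaussSum p α * jacobiTheta₂ z τ := by
  have hs := (hasSum_jacobiTheta₂_term z hτ).summable
  -- The Gaussian phases combine into the quadratic polynomial whose square is completed.
  have hterm (x : ZMod p) (n : ℤ) : ZMod.stdAddChar (α * x ^ 2) *
      jacobiTheta₂_term n (z + x.val / p) (-(2 * c / p) + τ) =
      ZMod.stdAddChar (α * x ^ 2 + x * n - c * n ^ 2 : ZMod p) * jacobiTheta₂_term n z τ := by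
    rw [jacobiTheta₂_term_translate, ← mul_assoc, ← AddChar.map_add_eq_mul, add_sub_assoc]
  have hsum (x : ZMod p) : Summable fun n : ℤ ↦
      (ZMod.stdAddChar (α * x ^ 2 + x * n - c * n ^ 2 : ZMod p) * jacobiTheta₂_term n z τ : ℂ) := by
    refine hs.norm.of_norm_bounded fun n ↦ ?_
    simp
  simp_rw [jacobiTheta₂, ← tsum_mul_left, hterm]
  rw [← Summable.tsum_finsetSum fun x _ ↦ hsum x]
  refine tsum_congr fun n ↦ ?_
  rw [← Finset.sum_mul, sum_stdAddChar_quadratic h]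

/-- The transformation law of the theta series under a matrix `(a b; c p)` of determinant one with
`p` prime and `2N ∣ b, c`. The automorphy factor depends neither on `N` nor on `h`. -/
theorem charTheta_mobius {N p : ℕ} [Fact p.Prime] (hN : 0 < N) (hpN : p ≡ 1 [MOD N])
    (hsq : IsSquare ((2 * N : ℕ) : ZMod p)) {a b c : ℤ} (hb : (2 * N : ℤ) ∣ b)
    (hc : (2 * N : ℤ) ∣ c) (hdet : a * p - b * c = 1) (h : ℤ) (z : ℂ) {τ : ℂ} (hτ : 0 < τ.im) :
    charTheta N h (z / (c * τ + p)) ((a * τ + b) / (c * τ + p)) =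
      thetaFactor p b c τ * Complex.exp (Real.pi * Complex.I * N * c * z ^ 2 / (c * τ + p)) *
        charTheta N h z τ := by
  obtain ⟨b, rfl⟩ := hb
  obtain ⟨c, rfl⟩ := hc
  have hp : p ≠ 0 := (Fact.out : p.Prime).ne_zero
  have hp' : (p : ℂ) ≠ 0 := by exact_mod_cast hp
  have hN' : (N : ℂ) ≠ 0 := by exact_mod_cast hN.ne'
  have hσ := im_div_pos (Nat.pos_of_ne_zero hp) (2 * N * c) hτ
  have hτ0 : τ ≠ 0 := by
    rintro rfl
    simp at hτ
  have hD : ((2 * N * c : ℤ) : ℂ) * τ + p ≠ 0 := by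
    intro h0
    rw [h0, div_zero] at hσ
    exact hσ.ne rfl
  have hσ0 : τ / ((2 * N * c : ℤ) * τ + p) ≠ 0 := div_ne_zero hτ0 hD
  have hτ' : 0 < (-1 / (N * τ)).im := by
    have := im_natCast_mul_pos hN hτ
    rw [div_eq_mul_inv, neg_one_mul, Complex.neg_im, Complex.inv_im, neg_div, neg_neg]
    exact div_pos this (Complex.normSq_pos.2 (by simp [hτ0, hN']))
  have hdet' : (4 * (b * N ^ 2 : ZMod p) * c : ZMod p) = -1 := by
    have := congrArg (Int.cast : ℤ → ZMod p) hdet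
    push_cast at this
    rw [CharP.cast_eq_zero] at this
    linear_combination -this
  -- `b N² = 2 N b (r / 2)²` where `r² = 2 N`.
  have hG : quadGaussSum p (b * N ^ 2 : ZMod p) = quadGaussSum p ((2 * N * b : ℤ) : ZMod p) := by
    obtain ⟨r, hr⟩ := hsq
    push_cast at hr
    have h4 : (b : ZMod p) * N ≠ 0 ∧ (2 : ZMod p) ≠ 0 := by
      constructor <;> intro h0
      · exact one_ne_zero (α := ZMod p) (by linear_combination hdet' - 4 * N * c * h0)
      · exact one_ne_zero (α := ZMod p) (by linear_combination hdet' - 2 * b * N ^ 2 * c * h0)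
    have hN0 : (N : ZMod p) ≠ 0 := right_ne_zero_of_mul h4.1
    have hr0 : r ≠ 0 := by
      rintro rfl
      exact mul_ne_zero h4.2 hN0 (by simpa using hr)
    rw [← quadGaussSum_mul_sq ((2 * N * b : ℤ) : ZMod p) (div_ne_zero hr0 h4.2)]
    congr 1
    push_cast
    rw [div_pow, mul_div_assoc', eq_div_iff (pow_ne_zero 2 h4.2)]
    linear_combination (2 * N * b : ZMod p) * hr
  rw [charTheta_mobius_eq_sum hN hpN (by linear_combination hdet) h _ hτ]
  set σ := τ / ((2 * N * c : ℤ) * τ + p) with hσdef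
  have hinv (x : ZMod p) : charTheta (N * p) (h * p + N * x.val) (z / ((2 * N * c : ℤ) * τ + p)) σ =
      1 / (N : ℂ) ^ (1 / 2 : ℂ) * (1 / (-Complex.I * (p * σ)) ^ (1 / 2 : ℂ)) *
      Complex.exp (-Real.pi * Complex.I * (N * p) * (z / ((2 * N * c : ℤ) * τ + p)) ^ 2 / σ) *
        jacobiTheta₂ (z / τ + h / N + x.val / p) (-(2 * c / p) + -1 / (N * τ)) := by
    rw [charTheta_inversion (Nat.mul_pos hN (Nat.pos_of_ne_zero hp)) _ _ hσ0]
    push_cast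
    rw [mul_assoc (N : ℂ) p σ, one_div_cpow_natCast_mul hN (mul_ne_zero hp' hσ0)]
    congr 2
    · rw [hσdef]
      push_cast at hD ⊢
      field_simp
      ring
    · rw [hσdef]
      push_cast at hD ⊢
      field_simp
      ring
  simp_rw [hinv, mul_left_comm _ (_ * Complex.exp _) _]
  rw [← Finset.mul_sum, sum_stdAddChar_mul_jacobiTheta₂ hdet' _ hτ', hG,
    charTheta_inversion hN h z hτ0, one_div_cpow_natCast_mul hN hτ0, thetaFactor, ← hσdef]
  have hexp : Complex.exp (-Real.pi * Complex.I * (N * p) *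
      (z / ((2 * N * c : ℤ) * τ + p)) ^ 2 / σ) =
      Complex.exp (Real.pi * Complex.I * N * (2 * N * c : ℤ) * z ^ 2 / ((2 * N * c : ℤ) * τ + p)) *
        Complex.exp (-Real.pi * Complex.I * N * z ^ 2 / τ) := by
    rw [← Complex.exp_add, hσdef]
    congr 1
    generalize ((2 * N * c : ℤ) : ℂ) = C at hD ⊢
    -- Eliminating `p = D - C τ` in favour of the denominator `D` makes the identity rational in `D`.
    obtain ⟨D, hpD⟩ : ∃ D, C * τ + p = D := ⟨_, rfl⟩
    rw [hpD] at hD ⊢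
    rw [← eq_sub_iff_add_eq'] at hpD
    rw [hpD]
    field_simp
    ring
  have hroot : (-Complex.I * τ) ^ (1 / 2 : ℂ) ≠ 0 := by
    rw [Complex.cpow_ne_zero_iff]
    exact Or.inl (mul_ne_zero (neg_ne_zero.2 Complex.I_ne_zero) hτ0)
  rw [hexp]
  field_simp

/-! ### Partial theta series -/

/-- Enumeration of the residue class of `h` modulo `N`. -/
def residueClassEquiv {N : ℕ} (hN : 0 < N) (h : ℤ) : ℤ ≃ {n : ℤ // n ≡ h [ZMOD (N : ℤ)]} where
  toFun m := ⟨h + N * m, by simp [Int.ModEq]⟩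
  invFun n := (n - h) / N
  left_inv m := by
    have hN' : (N : ℤ) ≠ 0 := by exact_mod_cast hN.ne'
    simp [Int.mul_ediv_cancel_left m hN']
  right_inv n := by
    have hdvd : (N : ℤ) ∣ n - h := Int.modEq_iff_dvd.1 n.2.symm
    ext
    simp [Int.mul_ediv_cancel' hdvd]

lemma partialTheta_eq_tsum {N : ℕ} (hN : 0 < N) (ε : ℕ) (h : ℤ) (τ : ℂ) :
    partialTheta ε N h τ = ∑' m : ℤ, ((h : ℂ) + N * m) ^ ε *
      Complex.exp (Real.pi * Complex.I * (h + N * m) ^ 2 / N * τ) := by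
  have hN' : (N : ℂ) ≠ 0 := by exact_mod_cast hN.ne'
  rw [partialTheta, ← (residueClassEquiv hN h).tsum_eq]
  refine tsum_congr fun m ↦ ?_
  simp only [residueClassEquiv, Equiv.coe_fn_mk]
  push_cast
  congr 2
  field_simp

lemma partialTheta_zero_eq {N : ℕ} (hN : 0 < N) (h : ℤ) (τ : ℂ) :
    partialTheta 0 N h τ = charTheta N h 0 τ := by
  simp [partialTheta_eq_tsum hN, charTheta]

/-- The series with `ε = 1` is, up to a constant, the Taylor coefficient of order one at `z = 0`
of the two-variable theta series. -/
lemma hasDerivAt_charTheta {N : ℕ} (hN : 0 < N) (h : ℤ) {τ : ℂ} (hτ : 0 < τ.im) :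
    HasDerivAt (fun z ↦ charTheta N h z τ)
      (2 * Real.pi * Complex.I * partialTheta 1 N h τ) 0 := by
  have hNτ := im_natCast_mul_pos hN hτ
  have h1 : HasDerivAt (fun z : ℂ ↦ Complex.exp (2 * Real.pi * Complex.I * h * z +
      Real.pi * Complex.I * h ^ 2 / N * τ))
      (Complex.exp (2 * Real.pi * Complex.I * h * 0 + Real.pi * Complex.I * h ^ 2 / N * τ) *
        (2 * Real.pi * Complex.I * h)) 0 := by
    simpa using (((hasDerivAt_id (0 : ℂ)).const_mul (2 * Real.pi * Complex.I * h)).add_const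
      (Real.pi * Complex.I * h ^ 2 / N * τ)).cexp
  have h2 : HasDerivAt (fun z : ℂ ↦ jacobiTheta₂ (N * z + h * τ) (N * τ))
      (jacobiTheta₂' (N * 0 + h * τ) (N * τ) * N) 0 := by
    refine HasDerivAt.comp (h := fun z : ℂ ↦ N * z + h * τ) (0 : ℂ)
      (hasDerivAt_jacobiTheta₂_fst (N * 0 + h * τ) hNτ) ?_
    simpa using ((hasDerivAt_id (0 : ℂ)).const_mul (N : ℂ)).add_const (h * τ)
  simp_rw [charTheta_eq_jacobiTheta₂ hN]
  refine (h1.mul h2).congr_deriv ?_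
  rw [partialTheta_eq_tsum hN, ← tsum_mul_left]
  have hs := (hasSum_jacobiTheta₂_term (N * 0 + h * τ) hNτ).mul_left
    (Complex.exp (2 * Real.pi * Complex.I * h * 0 + Real.pi * Complex.I * h ^ 2 / N * τ) *
      (2 * Real.pi * Complex.I * h))
  have hs' := ((hasSum_jacobiTheta₂'_term (N * 0 + h * τ) hNτ).mul_right (N : ℂ)).mul_left
    (Complex.exp (2 * Real.pi * Complex.I * h * 0 + Real.pi * Complex.I * h ^ 2 / N * τ))
  rw [← (hs.add hs').tsum_eq]
  refine tsum_congr fun m ↦ ?_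
  have hterm := charTheta_term_eq hN h m 0 τ
  rw [mul_zero, zero_add] at hterm
  rw [hterm, jacobiTheta₂'_term]
  ring

/-- The transformation law of the partial theta series, of weight `1/2 + ε`. -/
theorem partialTheta_mobius {N p : ℕ} [Fact p.Prime] (hN : 0 < N) (hpN : p ≡ 1 [MOD N])
    (hsq : IsSquare ((2 * N : ℕ) : ZMod p)) {a b c : ℤ} (hb : (2 * N : ℤ) ∣ b)
    (hc : (2 * N : ℤ) ∣ c) (hdet : a * p - b * c = 1) {ε : ℕ} (hε : ε = 0 ∨ ε = 1) (h : ℤ)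
    {τ : ℂ} (hτ : 0 < τ.im) :
    partialTheta ε N h ((a * τ + b) / (c * τ + p)) =
      thetaFactor p b c τ * (c * τ + p) ^ ε * partialTheta ε N h τ := by
  have key := fun z ↦ charTheta_mobius hN hpN hsq hb hc hdet h z hτ
  rcases hε with rfl | rfl
  · simpa [partialTheta_zero_eq hN] using key 0
  · have hp : 0 < p := (Fact.out : p.Prime).pos
    have hσ := im_div_pos hp c hτ
    have hD : (c : ℂ) * τ + p ≠ 0 := by
      intro h0
      rw [h0, div_zero] at hσ
      exact hσ.ne rfl
    have him : 0 < ((a * τ + b) / (c * τ + p)).im := by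
      rw [mobius_eq hp.ne' hdet hD, ← Complex.ofReal_natCast p, ← Complex.ofReal_intCast b,
        ← Complex.ofReal_div, Complex.add_im, Complex.ofReal_im, Complex.div_ofReal_im, zero_add]
      rw [← Complex.ofReal_natCast p] at hσ
      positivity
    have hl : HasDerivAt
        (fun z : ℂ ↦ charTheta N h (z / (c * τ + p)) ((a * τ + b) / (c * τ + p)))
        (2 * Real.pi * Complex.I * partialTheta 1 N h ((a * τ + b) / (c * τ + p)) *
          (1 / (c * τ + p))) 0 := by
      have hd := hasDerivAt_charTheta hN h him
      rw [← zero_div (c * τ + p : ℂ)] at hd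
      exact hd.comp (0 : ℂ) ((hasDerivAt_id (0 : ℂ)).div_const _)
    have he : HasDerivAt (fun z : ℂ ↦ Complex.exp (Real.pi * Complex.I * N * c * z ^ 2 /
        (c * τ + p))) 0 0 := by
      simpa using ((((hasDerivAt_id (0 : ℂ)).pow 2).const_mul
        (Real.pi * Complex.I * N * c)).div_const (c * τ + p : ℂ)).cexp
    have hr := (he.const_mul (thetaFactor p b c τ)).mul (hasDerivAt_charTheta hN h hτ)
    simp_rw [key] at hl
    -- The exponential factor is even in `z` and does not contribute to the derivative at `0`.
    have heq := hl.unique hr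
    have hπ : (Real.pi : ℂ) ≠ 0 := by exact_mod_cast Real.pi_ne_zero
    have hI := Complex.I_ne_zero
    simp only [mul_zero, zero_mul, zero_add, ne_eq, OfNat.ofNat_ne_zero, not_false_eq_true,
      zero_pow, zero_div, Complex.exp_zero, mul_one] at heq
    rw [mul_one_div, div_eq_iff hD] at heq
    refine mul_left_cancel₀ (mul_ne_zero (mul_ne_zero two_ne_zero hπ) hI) ?_
    rw [heq]
    ring

lemma partialTheta_add_mul {N : ℕ} (hN : 0 < N) (ε : ℕ) (h k : ℤ) (τ : ℂ) :
    partialTheta ε N h (τ + (2 * N * k : ℤ)) = partialTheta ε N h τ := by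
  have hN' : (N : ℂ) ≠ 0 := by exact_mod_cast hN.ne'
  rw [partialTheta_eq_tsum hN, partialTheta_eq_tsum hN]
  refine tsum_congr fun m ↦ ?_
  congr 1
  rw [Complex.exp_eq_exp_iff_exists_int]
  refine ⟨(h + N * m) ^ 2 * k, ?_⟩
  push_cast
  field_simp

/-- The pentagonal number theorem in terms of theta series: `η = ∑ (-1)^k q^{(6k+1)²/24}`, where
the terms with `k` even form the residue class of `1` modulo `12` and those with `k` odd the class
of `7`. -/
theorem eta_eq_partialTheta_sub {τ : ℂ} (hτ : 0 < τ.im) :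
    ModularForm.eta τ = partialTheta 0 12 1 τ - partialTheta 0 12 7 τ := by
  set F : ℤ → ℂ := fun k ↦
    (-1) ^ k * Complex.exp (2 * Real.pi * Complex.I * τ * ((6 * k + 1) ^ 2 / 24)) with hF
  -- In absolute value, these are the terms of a theta series of level `6` at `τ / 2`.
  have hsum : Summable F := by
    have hτ2 : 0 < (τ / 2).im := by
      rw [← Complex.ofReal_ofNat, Complex.div_ofReal_im]
      positivity
    refine (summable_charTheta (show 0 < 6 by norm_num) 1 0 hτ2).norm.of_norm_bounded fun k ↦ ?_
    rw [hF, norm_mul, norm_zpow, norm_neg, norm_one, one_zpow, one_mul]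
    refine le_of_eq ?_
    congr 2
    push_cast
    ring
  have hq : ‖Complex.exp (2 * Real.pi * Complex.I * τ)‖ < 1 :=
    UpperHalfPlane.norm_exp_two_pi_I_lt_one ⟨τ, hτ⟩
  have heta : ModularForm.eta τ = ∑' k : ℕ, (F k + F (-(k + 1))) := by
    rw [ModularForm.eta]
    simp_rw [ModularForm.eta_q_eq_pow]
    rw [tprod_one_sub_pow_eq_tsum hq, ← tsum_mul_left]
    refine tsum_congr fun k ↦ ?_
    have h1 : 2 * (pentagonal (-k) : ℂ) = k * (3 * k + 1) := by
      exact_mod_cast two_mul_natCast_pentagonal_neg k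
    have h2 : 2 * (pentagonal (k + 1) : ℂ) = (k + 1) * (3 * (k + 1) - 1) := by
      have := two_mul_natCast_pentagonal (k + 1)
      have := congrArg (Int.cast : ℤ → ℂ) this
      push_cast at this
      exact this
    -- The term of index `-(k + 1)` is the second one of the `k`th pair of the pentagonal series.
    have hsgn : (-1 : ℂ) ^ (-((k : ℤ) + 1)) = -(-1) ^ k := by
      rw [zpow_neg, zpow_add₀ (by norm_num), zpow_natCast]
      simp
      rcases Nat.even_or_odd k with hk | hk <;> simp [hk.neg_one_pow]
    simp only [hF, hsgn, zpow_natCast]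
    rw [← Complex.exp_nat_mul, ← Complex.exp_nat_mul, Function.Periodic.qParam, mul_left_comm,
      mul_sub, ← Complex.exp_add, ← Complex.exp_add, neg_mul, ← sub_eq_add_neg, ← mul_sub]
    congr 3
    · push_cast
      linear_combination Real.pi * Complex.I * τ * h1
    · push_cast
      linear_combination Real.pi * Complex.I * τ * h2
  have hZ : ∑' k : ℤ, F k = ModularForm.eta τ := by
    have hnat := hsum.comp_injective Nat.cast_injective
    have hneg := hsum.comp_injective (i := fun k : ℕ ↦ -((k : ℤ) + 1)) fun a b hab ↦ by
      simpa using hab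
    exact (tsum_of_nat_of_neg_add_one hnat hneg).trans
      ((hnat.tsum_add hneg).symm.trans heta.symm)
  rw [← hZ, tsum_int_eq_sum_zmod (d := 2) hsum, partialTheta_eq_tsum (by norm_num),
    partialTheta_eq_tsum (by norm_num), sub_eq_add_neg, ← tsum_neg]
  refine (Fin.sum_univ_two _).trans ?_
  congr 1 <;> refine tsum_congr fun l ↦ ?_
  · simp only [hF, ZMod.val, Fin.val_zero, zpow_add₀ (neg_ne_zero.2 (one_ne_zero (α := ℂ))),
      zpow_mul]
    norm_num
    ring_nf
  · simp only [hF, ZMod.val, Fin.val_one, zpow_add₀ (neg_ne_zero.2 (one_ne_zero (α := ℂ))),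
      zpow_mul]
    norm_num
    ring_nf

/-! ### Invariance of the quotient -/

lemma dvd_thetaLevel (N : ℕ) (hN : 0 < N) : 24 ∣ thetaLevel N ∧ 2 * N ∣ thetaLevel N := by
  obtain ⟨u, hu⟩ := Nat.gcd_dvd_left 12 N
  obtain ⟨v, hv⟩ := Nat.gcd_dvd_right 12 N
  have hg : 0 < Nat.gcd 12 N := Nat.gcd_pos_of_pos_right _ hN
  rw [thetaLevel]
  set g := Nat.gcd 12 N
  have h1 : 24 * N / g = 24 * v := by
    rw [hv, mul_left_comm, Nat.mul_div_cancel_left _ hg]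
  have h2 : 24 * v = 2 * N * u := by
    rw [show (24 : ℕ) = 2 * 12 from rfl, hu, hv]
    ring
  exact h1 ▸ ⟨⟨v, rfl⟩, ⟨u, h2⟩⟩

lemma eta_mobius {p : ℕ} [Fact p.Prime] (hp : p ≡ 1 [MOD 24]) {a b c : ℤ} (hb : 24 ∣ b)
    (hc : 24 ∣ c) (hdet : a * p - b * c = 1) {τ : ℂ} (hτ : 0 < τ.im)
    (hτ' : 0 < ((a * τ + b) / (c * τ + p)).im) :
    ModularForm.eta ((a * τ + b) / (c * τ + p)) = thetaFactor p b c τ * ModularForm.eta τ := by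
  have hsq : IsSquare ((2 * 12 : ℕ) : ZMod p) :=
    isSquare_natCast_zmod (by norm_num) (hp.of_dvd (by norm_num)) hp
  have key := partialTheta_mobius (N := 12) (by norm_num) (hp.of_dvd (by norm_num)) hsq
    (by simpa using hb) (by simpa using hc) hdet (Or.inl rfl : 0 = 0 ∨ 0 = 1) (hτ := hτ)
  rw [eta_eq_partialTheta_sub hτ, eta_eq_partialTheta_sub hτ', key, key]
  ring

/-- Invariance under matrices with prime lower right entry: the automorphy factor `J` of `η`
satisfies `J² = cτ + p`, so that `J (cτ + p)^ε = J^(1 + 2ε)`. -/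
lemma partialTheta_div_eta_mobius_prime {N p : ℕ} [Fact p.Prime] (hN : 0 < N)
    (hp : p ≡ 1 [MOD 24]) (hpN : p ≡ 1 [MOD 2 * N]) {a b c : ℤ} (hb : 24 ∣ b)
    (hc : 24 ∣ c) (hbN : (2 * N : ℤ) ∣ b) (hcN : (2 * N : ℤ) ∣ c) (hdet : a * p - b * c = 1)
    {ε : ℕ} (hε : ε = 0 ∨ ε = 1) (h : ℤ) {τ : ℂ} (hτ : 0 < τ.im)
    (hτ' : 0 < ((a * τ + b) / (c * τ + p)).im) :
    partialTheta ε N h ((a * τ + b) / (c * τ + p)) /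
        ModularForm.eta ((a * τ + b) / (c * τ + p)) ^ (1 + 2 * ε) =
      partialTheta ε N h τ / ModularForm.eta τ ^ (1 + 2 * ε) := by
  have hp8 : p % 8 = 1 := hp.of_dvd (m := 8) (by norm_num)
  have hp0 : (p : ZMod p) = 0 := CharP.cast_eq_zero _ p
  have hb0 : (b : ZMod p) ≠ 0 := by
    intro h0
    have := congrArg (Int.cast : ℤ → ZMod p) hdet
    push_cast at this
    rw [h0, hp0] at this
    simp at this
  have hτ0 : τ ≠ 0 := by
    rintro rfl
    simp at hτ
  have hD : (c : ℂ) * τ + p ≠ 0 := by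
    intro h0
    rw [h0, div_zero] at hτ'
    exact hτ'.ne rfl
  have hJ := thetaFactor_sq (c := c) (by omega) hb0 hτ0
  have hJ0 : thetaFactor p b c τ ≠ 0 := by
    intro h0
    rw [h0] at hJ
    exact hD (by simpa using hJ.symm)
  rw [partialTheta_mobius hN (hpN.of_mul_left 2)
    (isSquare_natCast_zmod (by omega) hp8 hpN) hbN hcN hdet hε h hτ,
    eta_mobius hp hb hc hdet hτ hτ', ← hJ, ← pow_mul, ← pow_succ', add_comm (2 * ε) 1, mul_pow,
    mul_div_mul_left _ _ (pow_ne_zero _ hJ0)]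

lemma partialTheta_div_eta_add {N L : ℕ} (hN : 0 < N) (hL : 24 ∣ L) (hLN : 2 * N ∣ L) (ε : ℕ)
    (h k : ℤ) {τ : ℂ} (hτ : 0 < τ.im) :
    partialTheta ε N h (τ + (L * k : ℤ)) / ModularForm.eta (τ + (L * k : ℤ)) ^ (1 + 2 * ε) =
      partialTheta ε N h τ / ModularForm.eta τ ^ (1 + 2 * ε) := by
  have hper {M : ℕ} (hM : 0 < M) (hLM : 2 * M ∣ L) (ε : ℕ) (h : ℤ) :
      partialTheta ε M h (τ + (L * k : ℤ)) = partialTheta ε M h τ := by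
    obtain ⟨v, rfl⟩ := hLM
    rw [← partialTheta_add_mul hM ε h (v * k) τ]
    congr 2
    push_cast
    ring
  have him : 0 < (τ + (L * k : ℤ)).im := by simpa using hτ
  rw [hper hN hLN, eta_eq_partialTheta_sub hτ, eta_eq_partialTheta_sub him,
    hper (by norm_num) hL, hper (by norm_num) hL]

/-- Invariance under the principal congruence subgroup of any level divisible by `24` and `2N`.
A right translation by a multiple of the level makes the lower right entry prime, by Dirichlet's
theorem. -/
theorem partialTheta_div_eta_mobius {N L : ℕ} (hN : 0 < N) (hL0 : L ≠ 0) (hL : 24 ∣ L)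
    (hLN : 2 * N ∣ L) {a b c d : ℤ} (hdet : a * d - b * c = 1) (hb : (L : ℤ) ∣ b)
    (hc : (L : ℤ) ∣ c) (hd : d ≡ 1 [ZMOD L]) {ε : ℕ} (hε : ε = 0 ∨ ε = 1) (h : ℤ) {τ : ℂ}
    (hτ : 0 < τ.im) (hτ' : 0 < ((a * τ + b) / (c * τ + d)).im) :
    partialTheta ε N h ((a * τ + b) / (c * τ + d)) /
        ModularForm.eta ((a * τ + b) / (c * τ + d)) ^ (1 + 2 * ε) =
      partialTheta ε N h τ / ModularForm.eta τ ^ (1 + 2 * ε) := by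
  have hLZ : (24 : ℤ) ∣ L := by exact_mod_cast hL
  have hLNZ : (2 * N : ℤ) ∣ L := by exact_mod_cast hLN
  -- If `c = 0`, then `d = 1`, since `-1` is not `1` modulo `24`.
  rcases eq_or_ne c 0 with rfl | hc0
  · have had : a * d = 1 := by linear_combination hdet
    have hd24 : d ≡ 1 [ZMOD 24] := hd.of_dvd hLZ
    have hd1 : d = 1 := by
      rcases Int.isUnit_iff.1 (IsUnit.of_mul_eq_one_right a had) with rfl | rfl
      · rfl
      · exact absurd hd24 (by decide)
    subst hd1
    obtain rfl : a = 1 := by linear_combination had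
    obtain ⟨k, rfl⟩ := hb
    simpa using partialTheta_div_eta_add hN hL hLN ε h k hτ
  · have hcop : IsCoprime d ((c.natAbs * L : ℕ) : ℤ) := by
      push_cast
      refine IsCoprime.mul_right ?_ ?_
      · refine (IsCoprime.abs_right_iff _ _).2 ?_
        exact ⟨a, -b, by linear_combination hdet⟩
      · obtain ⟨e, he⟩ := Int.modEq_iff_dvd.1 hd
        exact ⟨1, e, by linear_combination -he⟩
    obtain ⟨p, -, hp, hpd⟩ := Nat.forall_exists_prime_gt_and_zmodEq 0
      (Nat.mul_ne_zero (Int.natAbs_ne_zero.2 hc0) hL0) hcop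
    have : Fact p.Prime := ⟨hp⟩
    obtain ⟨k, hk⟩ : c * L ∣ p - d := by
      have hdvd := Int.modEq_iff_dvd.1 hpd.symm
      push_cast at hdvd
      rcases abs_choice c with hc' | hc' <;> rw [hc'] at hdvd
      · exact hdvd
      · rwa [neg_mul, neg_dvd] at hdvd
    have hpL : p ≡ 1 [MOD L] := by
      rw [← Int.natCast_modEq_iff, Nat.cast_one]
      refine (hpd.of_dvd ?_).trans hd
      push_cast
      exact dvd_mul_left _ _
    set τ₁ : ℂ := τ + (L * -k : ℤ) with hτ₁
    have him : 0 < τ₁.im := by simpa [hτ₁] using hτ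
    have hk' : (p : ℂ) - d = c * L * k := by exact_mod_cast hk
    have hmob : (a * τ + b) / (c * τ + d) =
        (a * τ₁ + (b + a * (L * k) : ℤ)) / (c * τ₁ + p) := by
      rw [hτ₁]
      push_cast
      congr 1
      · ring
      · linear_combination -hk'
    rw [← partialTheta_div_eta_add hN hL hLN ε h (-k) hτ, ← hτ₁, hmob]
    have hLb : (L : ℤ) ∣ b + a * (L * k) :=
      dvd_add hb (dvd_mul_of_dvd_right (dvd_mul_right _ _) _)
    exact partialTheta_div_eta_mobius_prime hN (hpL.of_dvd hL) (hpL.of_dvd hLN)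
      (hLZ.trans hLb) (hLZ.trans hc) (hLNZ.trans hLb) (hLNZ.trans hc)
      (by linear_combination hdet + a * hk) hε h him (hmob ▸ hτ')

theorem mainTheorem6 (N : ℕ) (hN : 0 < N) (ε : ℕ) (hε : ε = 0 ∨ ε = 1) (h : ℤ) :
    (∀ γ ∈ CongruenceSubgroup.Gamma (thetaLevel N), ∀ τ : ℍ,
      partialTheta ε N h ((γ • τ : ℍ) : ℂ) / ModularForm.eta ((γ • τ : ℍ) : ℂ) ^ (1 + 2 * ε) =
        partialTheta ε N h (τ : ℂ) / ModularForm.eta (τ : ℂ) ^ (1 + 2 * ε)) ∧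
    (∀ γ ∈ CongruenceSubgroup.Gamma (thetaLevel N * N), ∀ τ : ℍ,
      partialTheta ε N h (((γ • τ : ℍ) : ℂ) / (N : ℂ)) /
          ModularForm.eta (((γ • τ : ℍ) : ℂ) / (N : ℂ)) ^ (1 + 2 * ε) =
        partialTheta ε N h ((τ : ℂ) / (N : ℂ)) /
          ModularForm.eta ((τ : ℂ) / (N : ℂ)) ^ (1 + 2 * ε)) := by
  obtain ⟨hw, hwN⟩ := dvd_thetaLevel N hN
  have hw0 : thetaLevel N ≠ 0 := by
    rw [thetaLevel]
    exact (Nat.div_pos ((Nat.gcd_le_right 12 hN).trans (by omega))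
      (Nat.gcd_pos_of_pos_right _ hN)).ne'
  have hcoe (γ : SL(2, ℤ)) (τ : ℍ) :
      ((γ • τ : ℍ) : ℂ) = (γ 0 0 * τ + γ 0 1) / (γ 1 0 * τ + γ 1 1) := by
    rw [UpperHalfPlane.coe_specialLinearGroup_apply]
    simp
  have hdet (γ : SL(2, ℤ)) : γ 0 0 * γ 1 1 - γ 0 1 * γ 1 0 = 1 := by
    rw [← Matrix.det_fin_two, γ.det_coe]
  have hone {M : ℕ} {x : ℤ} (hx : (x : ZMod M) = 1) : x ≡ 1 [ZMOD M] := by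
    rw [← ZMod.intCast_eq_intCast_iff]
    simpa using hx
  constructor
  · intro γ hγ τ
    obtain ⟨-, hb, hc, hd⟩ := CongruenceSubgroup.Gamma_mem.1 hγ
    have him := (γ • τ).im_pos
    rw [← UpperHalfPlane.coe_im, hcoe] at him
    rw [hcoe]
    exact partialTheta_div_eta_mobius hN hw0 hw hwN (hdet γ)
      ((ZMod.intCast_zmod_eq_zero_iff_dvd _ _).1 hb) ((ZMod.intCast_zmod_eq_zero_iff_dvd _ _).1 hc)
      (hone hd) hε h τ.im_pos him
  · intro γ hγ τ
    obtain ⟨-, hb, hc, hd⟩ := CongruenceSubgroup.Gamma_mem.1 hγ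
    have hN' : (N : ℂ) ≠ 0 := by exact_mod_cast hN.ne'
    have hNR : (0 : ℝ) < N := by exact_mod_cast hN
    obtain ⟨b, hb⟩ := (ZMod.intCast_zmod_eq_zero_iff_dvd _ _).1 hb
    have hc := (ZMod.intCast_zmod_eq_zero_iff_dvd _ _).1 hc
    push_cast at hb hc
    have hNim (σ : ℍ) : 0 < ((σ : ℂ) / N).im := by
      rw [← Complex.ofReal_natCast, Complex.div_ofReal_im]
      exact div_pos σ.im_pos hNR
    -- Conjugation by `diag(N, 1)` carries the matrix `(a b; c d)` to `(a b/N; cN d)`.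
    have hconj : ((γ • τ : ℍ) : ℂ) / N =
        (γ 0 0 * (τ / N : ℂ) + (thetaLevel N * b : ℤ)) /
          ((γ 1 0 * N : ℤ) * (τ / N : ℂ) + γ 1 1) := by
      have hden : ((γ 1 0 * N : ℤ) : ℂ) * (τ / N : ℂ) = γ 1 0 * τ := by
        push_cast
        field_simp
      rw [hcoe, hb, hden, div_right_comm]
      congr 1
      push_cast
      field_simp
    have him := hNim (γ • τ)
    rw [hconj] at him ⊢
    refine partialTheta_div_eta_mobius hN hw0 hw hwN ?_ (dvd_mul_right _ _)
      (((dvd_mul_right _ _).trans hc).mul_right _) ((hone hd).of_dvd ?_) hε h (hNim τ) him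
    · have := hdet γ
      rw [hb] at this
      linear_combination this
    · push_cast
      exact dvd_mul_right _ _
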